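/- For Borel probability measures $\mu,\nu$ on $\mathbb{R}$ with finite second moment let $W_2^2(\mu,\nu)=\inf_\pi\int (x-y)^2\,d\pi(x,y)$, the infimum being over all couplings $\pi$ of $\mu$ and $\nu$, and let $\operatorname{bar}(\mu)=\int x\,d\mu(x)$. An optimal transport map from $\mu$ to $\nu$ is a map $T:\mathbb{R}\to\mathbb{R}$ with $T_\#\mu=\nu$ and $\int (x-T(x))^2\,d\mu(x)=W_2^2(\mu,\nu)$ that is the gradient of a convex function $\varphi$ on $\mathbb{R}$, in the sense that $T(x)\in\partial\varphi(x)$ for every $x$; it is unique if $\mu$ and $\nu$ have everywhere positive densities. Let $m=e^{-V}\mathcal{L}^1$ be a probability measure on $\mathbb{R}$, where $V\in C^\infty(\mathbb{R})$ is $\kappa$-convex for some $\kappa>0$, i.e. $V((1-t)x+ty)\le(1-t)V(x)+tV(y)-\frac{\kappa}{2}t(1-t)(x-y)^2$ for all $x,y\in\mathbb{R}$, $t\in[0,1]$, and suppose that $V$ attains its minimum at $0$. Let $F,G:\mathbb{R}\to\mathbb{R}$ be measurable functions such that $\int e^{\kappa F}dm$, $\int x^2e^{\kappa F}dm$, $\int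 e^{\kappa G}dm$ and $\int x^2e^{\kappa G}dm$ are finite. Put $\mu_F=e^{\kappa F}m/\int e^{\kappa F}dm$ and $\mu_G=e^{\kappa G}m/\int e^{\kappa G}dm$, let $\alpha_{m,F}$ and $\alpha_{m,G}$ be the values at $0$ of the optimal transport maps from $m$ to $\mu_F$ and from $m$ to $\mu_G$, and set $$\Phi(m,F,G)=-\alpha_{m,G}\operatorname{bar}(\mu_F)-\alpha_{m,F}\operatorname{bar}(\mu_G)+\alpha_{m,F}\alpha_{m,G}+(\alpha_{m,F}+\alpha_{m,G})\operatorname{bar}(m).$$ If $F(x)+G(y)\le (x-y)^2/2$ for all $x,y\in\mathbb{R}$, then $$\int_{\mathbb{R}}e^{\kappa F}dm\int_{\mathbb{R}}e^{\kappa G}dm\le e^{\kappa\Phi(m,F,G)}.$$ In particular, let $m=\gamma_1$ be the standard Gaussian measure on $\mathbb{R}$ and $\kappa=1$, with $F,G,\mu_F,\mu_G$ as above. Then $$\Phi(F,G):=\Phi(\gamma_1,F,G)=-\alpha_{\gamma_1,G}\operatorname{bar}(\mu_F)-\alpha_{\gamma_1,F}\operatorname{bar}(\mu_G)+\alpha_{\gamma_1,F}\alpha_{\gamma_1,G},$$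 and if $F(x)+G(y)\le (x-y)^2/2$ for all $x,y\in\mathbb{R}$, then $$\int_{\mathbb{R}}e^{F}d\gamma_1\int_{\mathbb{R}}e^{G}d\gamma_1\le\exp\bigl(\min\{\Phi(F,G),\,-\operatorname{bar}(\mu_F)\operatorname{bar}(\mu_G)\}\bigr).$$ -/

import Mathlib

open MeasureTheory ProbabilityTheory
open scoped ENNReal ContDiff

noncomputable section

/-- The measure `e^{-V} 𝓛¹` on the real line. -/
def gibbsMeasure (V : ℝ → ℝ) : Measure ℝ :=
  volume.withDensity fun x => ENNReal.ofReal (Real.exp (-V x))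

/-- The barycenter `∫ x dμ(x)`. -/
def bary (μ : Measure ℝ) : ℝ := ∫ x, x ∂μ

/-- The set of couplings of `μ` and `ν`: measures on the plane with marginals `μ` and `ν`. -/
def couplings (μ ν : Measure ℝ) : Set (Measure (ℝ × ℝ)) :=
  {π | π.fst = μ ∧ π.snd = ν}

/-- The square of the `L²`-Wasserstein distance, as an extended nonnegative number. -/
def wassersteinSq (μ ν : Measure ℝ) : ℝ≥0∞ :=
  ⨅ π ∈ couplings μ ν, ∫⁻ p, ENNReal.ofReal ((p.1 - p.2) ^ 2) ∂π

/-- `T` is an optimal transport map from `μ` to `ν`: it pushes `μ` forward to `ν`, it attains the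
squared Wasserstein distance, and it is the gradient of a convex function. As `T` is to be
evaluated at points, the last property is required at every point in the form
`T x ∈ ∂φ(x)`, that is, `φ x + T x * (y - x) ≤ φ y` for all `y`. When `μ` and `ν` have finite second
moments and both have an everywhere positive density, exactly one function has these properties. -/
structure IsOptimalTransportMap (μ ν : Measure ℝ) (T : ℝ → ℝ) : Prop where
  measurable : Measurable T
  map_eq : μ.map T = ν
  cost_eq : ∫⁻ x, ENNReal.ofReal ((x - T x) ^ 2) ∂μ = wassersteinSq μ ν
  gradient_convex : ∃ φ : ℝ → ℝ, ConvexOn ℝ Set.univ φ ∧ ∀ x y, φ x + T x * (y - x) ≤ φ y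

/-- The optimal transport map from `μ` to `ν`. -/
def optimalTransportMap (μ ν : Measure ℝ) : ℝ → ℝ :=
  Classical.epsilon (IsOptimalTransportMap μ ν)

/-- `α_{m,μ}`: the value at the mode of `m` of the optimal transport map from `m` to `μ`, for a
measure `m` whose mode is the origin. -/
def alpha (m μ : Measure ℝ) : ℝ := optimalTransportMap m μ 0

/-- The quantity `Φ`, as a function of the reference measure `m` with mode at the origin and of
two probability measures `μ` and `ν`. -/
def santaloPhi (m μ ν : Measure ℝ) : ℝ :=
  -alpha m ν * bary μ - alpha m μ * bary ν + alpha m μ * alpha m ν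
    + (alpha m μ + alpha m ν) * bary m

end

/-! The general bound is a transport argument. Let `T`, `S` be the optimal maps from `m` to the two
tilted measures, with values `a`, `b` at `0`. Taking logarithms in the Monge–Ampère equations,
adding them and using `F (T x) + G (S x) ≤ (T x - S x)² / 2` bounds the logarithm `L` of the product
of integrals by an expression in `T`, `S`, `V` and the logarithms of `T'`, `S'`.

The two maps are then merged into one monotone function `R`, with `R² = (T - a)(S - b)` and the sign
of `x`. By AM–GM, `√(T' S') ≤ R'`, and `T - a + S - b - 2R` has the sign of `x`, as does `V' - κx`.
With `κ`-convexity this gives `L - κφ ≤ -(a + b)V' + 2(R' - V'R) - 2(1 - xV')`, where `φ` integrates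
to `Φ` (`santalo_pointwise`). Against `e^{-V}` the right side is a derivative, up to the singular
part of `dR`, which has the favourable sign; its integral is at most `0` (`santalo_of_transport`).

The Gaussian bound with `-bar(μ_F) bar(μ_G)` starts from the even case, where both maps vanish at
`0` and `Φ = 0`. Even extension gives the inequality on half-lines. Moving the median of one weight
to `0` and adding the two half-line bounds gives the inequality after some linear tilt of the other
function; that tilt is harmless when the other weight is centered. Translating to the barycenter and
applying Jensen yields the general case (`integral_mul_integral_le_exp_bary`). -/

/-! ### Gibbs measures on the line and their distribution functions. -/

section Gibbs

open Set Filter Topology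

variable {U : ℝ → ℝ}

lemma integral_gibbsMeasure (hU : Measurable U) (f : ℝ → ℝ) :
    ∫ x, f x ∂gibbsMeasure U = ∫ x, Real.exp (-U x) * f x := by
  rw [gibbsMeasure, integral_withDensity_eq_integral_toReal_smul (by fun_prop) (by simp)]
  simp [ENNReal.toReal_ofReal (Real.exp_pos _).le]

lemma integrable_gibbsMeasure_iff (hU : Measurable U) (f : ℝ → ℝ) :
    Integrable f (gibbsMeasure U) ↔ Integrable (fun x => Real.exp (-U x) * f x) := by
  rw [gibbsMeasure, integrable_withDensity_iff_integrable_smul' (by fun_prop) (by simp)]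
  simp [ENNReal.toReal_ofReal (Real.exp_pos _).le]

lemma gibbsMeasure_absolutelyContinuous : gibbsMeasure U ≪ volume :=
  withDensity_absolutelyContinuous _ _

lemma absolutelyContinuous_gibbsMeasure (hU : Measurable U) : volume ≪ gibbsMeasure U :=
  withDensity_absolutelyContinuous' (by fun_prop) (by simp [Real.exp_pos])

instance : NullSingletonClass (gibbsMeasure U) := by unfold gibbsMeasure; infer_instance

lemma integrable_exp_neg (hU : Measurable U) [IsProbabilityMeasure (gibbsMeasure U)] :
    Integrable (fun x => Real.exp (-U x)) := by
  simpa using (integrable_gibbsMeasure_iff hU _).1 (integrable_const (1 : ℝ))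

lemma gibbsMeasure_real_apply (hU : Measurable U) {s : Set ℝ} (hs : MeasurableSet s) :
    (gibbsMeasure U).real s = ∫ x in s, Real.exp (-U x) := by
  rw [← integral_indicator_one hs, integral_gibbsMeasure hU, ← integral_indicator hs]
  congr 1 with x
  by_cases hx : x ∈ s <;> simp [hx]

lemma cdf_gibbsMeasure_sub (hU : Measurable U) [IsProbabilityMeasure (gibbsMeasure U)] (a x : ℝ) :
    cdf (gibbsMeasure U) x - cdf (gibbsMeasure U) a = ∫ t in a..x, Real.exp (-U t) := by
  rw [cdf_eq_real, cdf_eq_real, gibbsMeasure_real_apply hU measurableSet_Iic,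
    gibbsMeasure_real_apply hU measurableSet_Iic, intervalIntegral.integral_Iic_sub_Iic] <;>
  exact (integrable_exp_neg hU).integrableOn

lemma strictMono_cdf_gibbsMeasure (hU : Measurable U) [IsProbabilityMeasure (gibbsMeasure U)] :
    StrictMono (cdf (gibbsMeasure U)) := by
  intro a b hab
  rw [← sub_pos, cdf_gibbsMeasure_sub hU]
  exact intervalIntegral.intervalIntegral_pos_of_pos
    (integrable_exp_neg hU).intervalIntegrable (fun x => Real.exp_pos _) hab

lemma continuous_cdf_gibbsMeasure (hU : Measurable U) [IsProbabilityMeasure (gibbsMeasure U)] :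
    Continuous (cdf (gibbsMeasure U)) := by
  have : (cdf (gibbsMeasure U) : ℝ → ℝ) =
      fun x => cdf (gibbsMeasure U) 0 + ∫ t in (0 : ℝ)..x, Real.exp (-U t) := by
    ext x; rw [← cdf_gibbsMeasure_sub hU]; ring
  rw [this]
  exact continuous_const.add ((integrable_exp_neg hU).continuous_primitive 0)

lemma ae_hasDerivAt_cdf_gibbsMeasure (hU : Measurable U)
    [IsProbabilityMeasure (gibbsMeasure U)] :
    ∀ᵐ x, HasDerivAt (cdf (gibbsMeasure U)) (Real.exp (-U x)) x := by
  filter_upwards [LocallyIntegrable.ae_hasDerivAt_integral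
    (integrable_exp_neg hU).locallyIntegrable] with x hx
  have : (cdf (gibbsMeasure U) : ℝ → ℝ) =
      fun x => cdf (gibbsMeasure U) 0 + ∫ t in (0 : ℝ)..x, Real.exp (-U t) := by
    ext x; rw [← cdf_gibbsMeasure_sub hU]; ring
  rw [this]
  exact (hx 0).const_add _

lemma exists_cdf_eq {V : ℝ → ℝ} (hU : Measurable U) (hV : Measurable V)
    [IsProbabilityMeasure (gibbsMeasure U)] [IsProbabilityMeasure (gibbsMeasure V)] (x : ℝ) :
    ∃ y, cdf (gibbsMeasure U) y = cdf (gibbsMeasure V) x := by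
  have h0 : 0 < cdf (gibbsMeasure V) x :=
    (cdf_nonneg _ (x - 1)).trans_lt (strictMono_cdf_gibbsMeasure hV (by linarith))
  have h1 : cdf (gibbsMeasure V) x < 1 :=
    (strictMono_cdf_gibbsMeasure hV (show x < x + 1 by linarith)).trans_le (cdf_le_one _ (x + 1))
  obtain ⟨a, ha⟩ := ((tendsto_cdf_atBot (gibbsMeasure U)).eventually_lt_const h0).exists
  obtain ⟨b, hb⟩ := ((tendsto_cdf_atTop (gibbsMeasure U)).eventually_const_lt h1).exists
  exact mem_range_of_exists_le_of_exists_ge (continuous_cdf_gibbsMeasure hU) ⟨a, ha.le⟩ ⟨b, hb.le⟩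

/-- Tilting stays within Gibbs measures, so the lemmas that ask only for a measurable potential
apply to `μ_F` and `μ_G`. -/
lemma tilted_gibbsMeasure (hU : Measurable U) {f : ℝ → ℝ} (hf : Measurable f)
    [IsProbabilityMeasure (gibbsMeasure U)]
    (hi : Integrable (fun x => Real.exp (f x)) (gibbsMeasure U)) :
    (gibbsMeasure U).tilted f = gibbsMeasure
      (fun x => U x - f x + Real.log (∫ x, Real.exp (f x) ∂gibbsMeasure U)) := by
  have hZ : 0 < ∫ x, Real.exp (f x) ∂gibbsMeasure U := integral_exp_pos hi
  rw [Measure.tilted]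
  generalize (∫ x, Real.exp (f x) ∂gibbsMeasure U) = Z at hZ
  rw [gibbsMeasure, gibbsMeasure, ← withDensity_mul _ (by fun_prop) (by fun_prop)]
  congr 1 with x
  rw [Pi.mul_apply, ← ENNReal.ofReal_mul (Real.exp_pos _).le]
  congr 1
  rw [neg_add, Real.exp_add, neg_sub, sub_eq_add_neg, Real.exp_add, Real.exp_neg (Real.log Z),
    Real.exp_log hZ]
  field_simp

lemma integrable_tilted_iff_mul_exp (f g : ℝ → ℝ) {m : Measure ℝ}
    (hi : Integrable (fun x => Real.exp (f x)) m) :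
    Integrable g (m.tilted f) ↔ Integrable (fun x => g x * Real.exp (f x)) m := by
  rw [integrable_tilted_iff hi]
  simp [mul_comm]

end Gibbs

/-! ### Monotone optimal transport and the Monge–Ampère equation. -/

section Transport

open Set Filter Topology

lemma monotone_of_forall_subgradient {φ T : ℝ → ℝ}
    (h : ∀ x y, φ x + T x * (y - x) ≤ φ y) : Monotone T := by
  intro x y hxy
  rcases hxy.eq_or_lt with rfl | hlt
  · rfl
  have h1 := h x y
  have h2 := h y x
  by_contra! hT
  nlinarith [mul_pos (sub_pos.2 hT) (sub_pos.2 hlt)]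

lemma convexOn_of_forall_subgradient {φ T : ℝ → ℝ}
    (h : ∀ x y, φ x + T x * (y - x) ≤ φ y) : ConvexOn ℝ Set.univ φ := by
  refine ⟨convex_univ, fun x _ y _ a b ha hb hab => ?_⟩
  simp only [smul_eq_mul]
  set z := a * x + b * y with hz
  have h1 := mul_le_mul_of_nonneg_left (h z x) ha
  have h2 := mul_le_mul_of_nonneg_left (h z y) hb
  have h3 : a * (φ z + T z * (x - z)) + b * (φ z + T z * (y - z)) = φ z := by
    have : b = 1 - a := by linarith
    rw [this] at hz ⊢
    rw [hz]; ring
  linarith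

lemma Monotone.integral_subgradient {T : ℝ → ℝ} (hT : Monotone T) (x y : ℝ) :
    (∫ t in (0 : ℝ)..x, T t) + T x * (y - x) ≤ ∫ t in (0 : ℝ)..y, T t := by
  have hI : ∀ a b, IntervalIntegrable T volume a b := fun a b => hT.intervalIntegrable
  have h1 := intervalIntegral.integral_add_adjacent_intervals (hI 0 x) (hI x y)
  rw [← h1]
  gcongr
  rcases le_total x y with hxy | hxy
  · have := intervalIntegral.integral_mono_on hxy intervalIntegrable_const (hI x y)
      (fun t ht => hT ht.1)
    simpa [mul_comm] using this
  · have := intervalIntegral.integral_mono_on hxy (hI y x) intervalIntegrable_const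
      (fun t ht => hT ht.2)
    rw [intervalIntegral.integral_symm]
    simp only [intervalIntegral.integral_const, smul_eq_mul] at this
    linarith

/-- A pair of dual potentials certifies optimality. -/
lemma lintegral_sq_eq_wassersteinSq {μ ν : Measure ℝ} {T a b : ℝ → ℝ}
    (hT : Measurable T) (hmap : μ.map T = ν)
    (hab : ∀ x y, a x + b y ≤ (x - y) ^ 2) (heq : ∀ x, a x + b (T x) = (x - T x) ^ 2)
    (ha : Integrable a μ) (hb : Integrable b ν) :
    ∫⁻ x, ENNReal.ofReal ((x - T x) ^ 2) ∂μ = wassersteinSq μ ν := by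
  apply le_antisymm
  · refine le_iInf₂ fun π hπ => ?_
    obtain ⟨h1, h2⟩ := hπ
    have hbT : Integrable (fun x => b (T x)) μ := by
      rw [← hmap] at hb
      exact hb.comp_measurable hT
    have ha' : Integrable (fun p : ℝ × ℝ => a p.1) π := by
      rw [← h1, Measure.fst] at ha
      exact ha.comp_measurable measurable_fst
    have hb' : Integrable (fun p : ℝ × ℝ => b p.2) π := by
      rw [← h2, Measure.snd] at hb
      exact hb.comp_measurable measurable_snd
    have hcost : Integrable (fun x => (x - T x) ^ 2) μ := by
      refine (ha.add hbT).congr (ae_of_all _ fun x => ?_)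
      simp [heq]
    calc ∫⁻ x, ENNReal.ofReal ((x - T x) ^ 2) ∂μ
        = ENNReal.ofReal (∫ x, (x - T x) ^ 2 ∂μ) :=
          (ofReal_integral_eq_lintegral_ofReal hcost (ae_of_all _ fun x => sq_nonneg _)).symm
      _ = ENNReal.ofReal (∫ p, (a p.1 + b p.2) ∂π) := by
          congr 1
          simp_rw [← heq]
          rw [integral_add ha hbT, integral_add ha' hb']
          congr 1
          · conv_lhs => rw [← h1, Measure.fst]
            rw [integral_map measurable_fst.aemeasurable]
            rw [← Measure.fst, h1]; exact ha.aestronglyMeasurable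
          · have e1 := integral_map (μ := μ) (f := b) hT.aemeasurable
              (by rw [hmap]; exact hb.aestronglyMeasurable)
            rw [← e1, hmap]
            conv_lhs => rw [← h2, Measure.snd]
            rw [integral_map measurable_snd.aemeasurable]
            rw [← Measure.snd, h2]; exact hb.aestronglyMeasurable
      -- `a + b` may be negative and the cost of `π` may be infinite; only the positive part is
      -- kept.
      _ ≤ ∫⁻ p, ENNReal.ofReal (a p.1 + b p.2) ∂π := by
          have hi : Integrable (fun p : ℝ × ℝ => a p.1 + b p.2) π := ha'.add hb'
          rw [integral_eq_lintegral_pos_part_sub_lintegral_neg_part hi]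
          refine ENNReal.ofReal_le_of_le_toReal ?_
          exact sub_le_self _ ENNReal.toReal_nonneg
      _ ≤ ∫⁻ p, ENNReal.ofReal ((p.1 - p.2) ^ 2) ∂π :=
          lintegral_mono fun p => ENNReal.ofReal_le_ofReal (hab _ _)
  · have hm : Measurable fun x => (x, T x) := by fun_prop
    have hc : μ.map (fun x => (x, T x)) ∈ couplings μ ν := by
      constructor
      · rw [Measure.fst_map_prodMk hT]; exact Measure.map_id
      · rw [Measure.snd_map_prodMk (X := fun x => x) measurable_id]; exact hmap
    refine (iInf₂_le _ hc).trans ?_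
    rw [lintegral_map (by fun_prop) hm]

/-- A monotone map between measures with finite second moments is optimal. -/
lemma isOptimalTransportMap_of_monotone {μ ν : Measure ℝ} [IsFiniteMeasure μ] {T S : ℝ → ℝ}
    (hT : Monotone T) (hS : Measurable S) (hTS : ∀ y, T (S y) = y) (hmap : μ.map T = ν)
    (hμ : Integrable (fun x => x ^ 2) μ) (hν : Integrable (fun x => x ^ 2) ν) :
    IsOptimalTransportMap μ ν T := by
  set φ : ℝ → ℝ := fun x => ∫ t in (0 : ℝ)..x, T t with hφ
  have hsub : ∀ x y, φ x + T x * (y - x) ≤ φ y := hT.integral_subgradient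
  have hconv := convexOn_of_forall_subgradient hsub
  have hφm : Measurable φ := by
    have : Continuous φ := intervalIntegral.continuous_primitive (fun a b => hT.intervalIntegrable) 0
    exact this.measurable
  have hTm : Measurable T := hT.measurable
  refine ⟨hTm, hmap, ?_, φ, hconv, hsub⟩
  have hT2 : Integrable (fun x => T x ^ 2) μ := by
    rw [← hmap] at hν
    exact hν.comp_measurable hTm
  have hbound : ∀ {f : ℝ → ℝ}, Measurable f → Integrable (fun x => f x ^ 2) μ → Integrable f μ := by
    intro f hf h2
    refine Integrable.mono' (h2.add (integrable_const 1)) hf.aestronglyMeasurable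
      (ae_of_all _ fun x => ?_)
    simp only [Pi.add_apply, Real.norm_eq_abs]
    nlinarith [sq_abs (f x), sq_nonneg (|f x| - 1)]
  have hx1 : Integrable (fun x => x) μ := hbound measurable_id hμ
  have hxT : Integrable (fun x => x * T x) μ := by
    refine Integrable.mono' (hμ.add hT2) (by fun_prop) (ae_of_all _ fun x => ?_)
    simp only [Pi.add_apply, Real.norm_eq_abs, abs_mul]
    nlinarith [sq_abs (T x), sq_abs x, sq_nonneg (|x| - |T x|), sq_nonneg (|x|), sq_nonneg (|T x|)]
  have hφ0 : φ 0 = 0 := by simp [hφ]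
  -- The subgradient inequalities between `0` and `x` give `T 0 * x ≤ φ x ≤ x * T x`.
  have hφi : Integrable φ μ := by
    refine Integrable.mono' (hxT.abs.add (hx1.abs.const_mul |T 0|)) hφm.aestronglyMeasurable
      (ae_of_all _ fun x => ?_)
    simp only [Pi.add_apply, Real.norm_eq_abs]
    have h1 := hsub 0 x
    have h2 := hsub x 0
    rw [hφ0] at h1 h2
    have h3 := neg_abs_le (T 0 * x)
    have h4 := le_abs_self (x * T x)
    rw [abs_mul] at h3
    rw [abs_le]
    constructor
    · nlinarith [abs_nonneg (x * T x)]
    · nlinarith [mul_nonneg (abs_nonneg (T 0)) (abs_nonneg x)]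
  -- Kantorovich potentials: `y * S y - φ (S y)` is the Legendre transform of `φ` at `y`, because `y
  -- = T (S y)` is a subgradient at `S y`. The two conditions are Young's inequality and its
  -- equality case.
  refine lintegral_sq_eq_wassersteinSq (a := fun x => x ^ 2 - 2 * φ x)
    (b := fun y => y ^ 2 - 2 * (y * S y - φ (S y))) hTm hmap ?_ ?_ (hμ.sub (hφi.const_mul 2)) ?_
  · intro x y
    have := hsub (S y) x
    rw [hTS] at this
    nlinarith
  · intro x
    have h1 := hsub (S (T x)) x
    have h2 := hsub x (S (T x))
    rw [hTS] at h1
    have : φ x = φ (S (T x)) + T x * (x - S (T x)) := by linarith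
    rw [this]; ring
  · rw [← hmap, integrable_map_measure (by fun_prop) hTm.aemeasurable]
    have : (fun y => y ^ 2 - 2 * (y * S y - φ (S y))) ∘ T =
        fun x => T x ^ 2 - 2 * (x * T x - φ x) := by
      ext x
      have h1 := hsub (S (T x)) x
      have h2 := hsub x (S (T x))
      rw [hTS] at h1
      have : φ x = φ (S (T x)) + T x * (x - S (T x)) := by linarith
      simp only [Function.comp]
      rw [this]; ring
    rw [this]
    exact hT2.sub ((hxT.sub hφi).const_mul 2)

variable {U V : ℝ → ℝ}

/-- The map is the monotone rearrangement, which matches the distribution functions; exchanging the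
two measures gives its inverse. -/
lemma exists_isOptimalTransportMap (hU : Measurable U) (hV : Measurable V)
    [IsProbabilityMeasure (gibbsMeasure U)] [IsProbabilityMeasure (gibbsMeasure V)]
    (hU2 : Integrable (fun x => x ^ 2) (gibbsMeasure U))
    (hV2 : Integrable (fun x => x ^ 2) (gibbsMeasure V)) :
    ∃ T, IsOptimalTransportMap (gibbsMeasure V) (gibbsMeasure U) T := by
  choose T hT using exists_cdf_eq hU hV
  choose S hS using exists_cdf_eq hV hU
  have hTS : ∀ y, T (S y) = y := fun y =>
    (strictMono_cdf_gibbsMeasure hU).injective ((hT _).trans (hS y))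
  have hTmono : StrictMono T := fun x y hxy => by
    rw [← (strictMono_cdf_gibbsMeasure hU).lt_iff_lt, hT, hT]
    exact strictMono_cdf_gibbsMeasure hV hxy
  have hSmono : StrictMono S := fun x y hxy => by
    rw [← (strictMono_cdf_gibbsMeasure hV).lt_iff_lt, hS, hS]
    exact strictMono_cdf_gibbsMeasure hU hxy
  refine ⟨T, isOptimalTransportMap_of_monotone hTmono.monotone hSmono.monotone.measurable hTS
    ?_ hV2 hU2⟩
  have hTm := hTmono.monotone.measurable
  have := Measure.isProbabilityMeasure_map (μ := gibbsMeasure V) hTm.aemeasurable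
  refine Measure.ext_of_Iic _ _ fun y => ?_
  rw [Measure.map_apply hTm measurableSet_Iic]
  have : T ⁻¹' Iic y = Iic (S y) := by
    ext x
    simp only [mem_preimage, mem_Iic]
    rw [← hTmono.le_iff_le (b := S y), hTS]
  rw [this, ← ofReal_cdf, ← ofReal_cdf, hS]

lemma optimalTransportMap_spec (hU : Measurable U) (hV : Measurable V)
    [IsProbabilityMeasure (gibbsMeasure U)] [IsProbabilityMeasure (gibbsMeasure V)]
    (hU2 : Integrable (fun x => x ^ 2) (gibbsMeasure U))
    (hV2 : Integrable (fun x => x ^ 2) (gibbsMeasure V)) :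
    IsOptimalTransportMap (gibbsMeasure V) (gibbsMeasure U)
      (optimalTransportMap (gibbsMeasure V) (gibbsMeasure U)) :=
  Classical.epsilon_spec (exists_isOptimalTransportMap hU hV hU2 hV2)

namespace IsOptimalTransportMap

variable {T : ℝ → ℝ}

lemma monotone {μ ν : Measure ℝ} (h : IsOptimalTransportMap μ ν T) : Monotone T := by
  obtain ⟨φ, -, hφ⟩ := h.gradient_convex
  exact monotone_of_forall_subgradient hφ

/-- Monotonicity identifies the preimage of `Iic (T x)` with `Iic x` up to a level set of `T`, which
is null because the target has no atoms. This determines the map at every point, hence also its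
value at `0`. -/
lemma cdf_eq [IsProbabilityMeasure (gibbsMeasure U)] [IsProbabilityMeasure (gibbsMeasure V)]
    (h : IsOptimalTransportMap (gibbsMeasure V) (gibbsMeasure U) T) (x : ℝ) :
    cdf (gibbsMeasure U) (T x) = cdf (gibbsMeasure V) x := by
  have hm := h.monotone
  rw [cdf_eq_real, cdf_eq_real, measureReal_def, measureReal_def]
  congr 1
  conv_lhs => rw [← h.map_eq, Measure.map_apply h.measurable measurableSet_Iic]
  have h0 : gibbsMeasure V (T ⁻¹' {T x}) = 0 := by
    rw [← Measure.map_apply h.measurable (measurableSet_singleton _), h.map_eq]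
    exact measure_singleton _
  apply le_antisymm
  · have : T ⁻¹' Iic (T x) ⊆ Iic x ∪ T ⁻¹' {T x} := by
      intro z hz
      rcases le_total z x with hzx | hzx
      · exact Or.inl hzx
      · exact Or.inr (le_antisymm hz (hm hzx))
    refine (measure_mono this).trans ((measure_union_le _ _).trans ?_)
    rw [h0, add_zero]
  · exact measure_mono fun z hz => hm hz

lemma strictMono (hV : Measurable V)
    [IsProbabilityMeasure (gibbsMeasure U)] [IsProbabilityMeasure (gibbsMeasure V)]
    (h : IsOptimalTransportMap (gibbsMeasure V) (gibbsMeasure U) T) : StrictMono T := by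
  refine h.monotone.strictMono_of_injective fun x y hxy => ?_
  apply (strictMono_cdf_gibbsMeasure hV).injective
  rw [← h.cdf_eq, ← h.cdf_eq, hxy]

/-- The Monge–Ampère equation. -/
lemma ae_exp_mul_deriv (hU : Measurable U) (hV : Measurable V)
    [IsProbabilityMeasure (gibbsMeasure U)] [IsProbabilityMeasure (gibbsMeasure V)]
    (h : IsOptimalTransportMap (gibbsMeasure V) (gibbsMeasure U) T) :
    ∀ᵐ x, Real.exp (-U (T x)) * deriv T x = Real.exp (-V x) := by
  -- The distribution function of the target is known to be differentiable only almost everywhere.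
  -- The preimage of the bad set is null because `T` pushes one measure equivalent to Lebesgue
  -- measure to an absolutely continuous one.
  have h1 : ∀ᵐ x, HasDerivAt (cdf (gibbsMeasure U)) (Real.exp (-U (T x))) (T x) := by
    apply absolutelyContinuous_gibbsMeasure hV
    have h2 : ∀ᵐ y ∂(gibbsMeasure V).map T,
        HasDerivAt (cdf (gibbsMeasure U)) (Real.exp (-U y)) y := by
      rw [h.map_eq]
      exact gibbsMeasure_absolutelyContinuous.ae_le (ae_hasDerivAt_cdf_gibbsMeasure hU)
    exact ae_of_ae_map h.measurable.aemeasurable h2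
  filter_upwards [h1, ae_hasDerivAt_cdf_gibbsMeasure hV, h.monotone.ae_differentiableAt]
    with x hx1 hx2 hx3
  have h3 := hx1.comp x hx3.hasDerivAt
  have h4 : (cdf (gibbsMeasure U) : ℝ → ℝ) ∘ T = cdf (gibbsMeasure V) := funext h.cdf_eq
  rw [h4] at h3
  exact h3.unique hx2

end IsOptimalTransportMap

end Transport

/-! ### Integration by parts for monotone functions, and vanishing sequences. -/

section MonotoneWeights

open Set Filter Topology

/-- Integration by parts, as an inequality, for a monotone function against a weight that
increases on the left of the origin and decreases on the right of it. -/
lemma Monotone.integral_deriv_mul_le {R h h' : ℝ → ℝ} (hR : Monotone R)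
    (hh : ∀ x, HasDerivAt h (h' x) x) (hc : Continuous h') (h0 : ∀ x, 0 ≤ h x)
    (hneg : ∀ x, x ≤ 0 → 0 ≤ h' x) (hpos : ∀ x, 0 ≤ x → h' x ≤ 0) {a b : ℝ} (hab : a ≤ b) :
    IntervalIntegrable (fun x => deriv R x * h x) volume a b ∧
      ∫ x in a..b, deriv R x * h x ≤ R b * h b - R a * h a - ∫ x in a..b, R x * h' x := by
  have hloc : LocallyIntegrable (fun x => R x * h' x) := by
    have := (hR.locallyIntegrable (μ := volume)).smul_continuous (g := h') hc
    simpa [mul_comm] using this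
  have hI : ∀ x y, IntervalIntegrable (fun x => R x * h' x) volume x y := fun x y =>
    hR.intervalIntegrable.mul_continuousOn hc.continuousOn
  have hFTC : ∀ x y, ∫ t in x..y, h' t = h y - h x := fun x y =>
    intervalIntegral.integral_eq_sub_of_hasDerivAt (fun t _ => hh t) (hc.intervalIntegrable _ _)
  -- Formally `dP = h dR ≥ 0`. Once `P` is known to be monotone, the integral of its almost
  -- everywhere derivative `R' h` is at most its increment; a singular part of `dR` can only help.
  set P : ℝ → ℝ := fun x => R x * h x - ∫ t in (0 : ℝ)..x, R t * h' t with hP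
  have hsub : ∀ x y, P y - P x = R y * h y - R x * h x - ∫ t in x..y, R t * h' t := fun x y => by
    rw [← intervalIntegral.integral_interval_sub_left (hI 0 y) (hI 0 x)]
    simp only [hP]; ring
  have hPneg : MonotoneOn P (Iic 0) := by
    intro x _ y hy hxy
    rw [← sub_nonneg, hsub]
    have h1 : ∫ t in x..y, R t * h' t ≤ ∫ t in x..y, R y * h' t :=
      intervalIntegral.integral_mono_on hxy (hI x y) ((hc.const_mul _).intervalIntegrable _ _)
        fun t ht => mul_le_mul_of_nonneg_right (hR ht.2) (hneg t (ht.2.trans hy))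
    rw [intervalIntegral.integral_const_mul, hFTC] at h1
    nlinarith [mul_nonneg (sub_nonneg.2 (hR hxy)) (h0 x)]
  have hPpos : MonotoneOn P (Ici 0) := by
    intro x hx y _ hxy
    rw [← sub_nonneg, hsub]
    have h1 : ∫ t in x..y, R t * h' t ≤ ∫ t in x..y, R x * h' t :=
      intervalIntegral.integral_mono_on hxy (hI x y) ((hc.const_mul _).intervalIntegrable _ _)
        fun t ht => mul_le_mul_of_nonpos_right (hR ht.1) (hpos t (le_trans hx ht.1))
    rw [intervalIntegral.integral_const_mul, hFTC] at h1
    nlinarith [mul_nonneg (sub_nonneg.2 (hR hxy)) (h0 y)]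
  have hPm : Monotone P := by
    rw [← monotoneOn_univ, ← Iic_union_Ici (a := (0 : ℝ))]
    exact hPneg.union_right hPpos isGreatest_Iic isLeast_Ici
  have hd : ∀ᵐ x, deriv P x = deriv R x * h x := by
    filter_upwards [hR.ae_differentiableAt, LocallyIntegrable.ae_hasDerivAt_integral hloc] with x h1 h2
    have := (h1.hasDerivAt.mul (hh x)).sub (h2 0)
    rw [HasDerivAt.deriv (f := P) this]
    ring
  have hmon : MonotoneOn P (uIcc a b) := hPm.monotoneOn _
  have hint := hmon.intervalIntegrable_deriv
  have hval := hmon.intervalIntegral_deriv_mem_uIcc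
  constructor
  · exact hint.congr_ae (ae_restrict_of_ae hd)
  · rw [uIcc_of_le (sub_nonneg.2 (hPm hab)), hsub] at hval
    rw [← intervalIntegral.integral_congr_ae (hd.mono fun x hx _ => hx)]
    exact hval.2

/-- Boundary terms need not be shown to converge: integrability makes them small along some
sequence, which suffices. -/
lemma MeasureTheory.Integrable.exists_ge_lt {q : ℝ → ℝ} (hq : Integrable q) {ε : ℝ} (hε : 0 < ε)
    (N : ℝ) : ∃ b, N ≤ b ∧ q b < ε := by
  by_contra! hcon
  have h1 : IntegrableOn (fun _ : ℝ => ε) (Ici N) := by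
    refine Integrable.mono' hq.integrableOn (by fun_prop) ?_
    filter_upwards [ae_restrict_mem measurableSet_Ici] with x hx
    rw [Real.norm_of_nonneg hε.le]
    exact hcon x hx
  rw [integrableOn_const_iff] at h1
  simp [hε.ne'] at h1

lemma MeasureTheory.Integrable.exists_seq_atTop {q : ℝ → ℝ} (hq : Integrable q)
    (h0 : ∀ x, 0 ≤ q x) : ∃ b : ℕ → ℝ, (∀ n, 0 ≤ b n) ∧ Tendsto b atTop atTop ∧
      Tendsto (fun n => q (b n)) atTop (𝓝 0) := by
  choose b hb using fun n : ℕ => hq.exists_ge_lt (Nat.one_div_pos_of_nat (α := ℝ) (n := n)) n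
  refine ⟨b, fun n => (Nat.cast_nonneg n).trans (hb n).1,
    tendsto_atTop_mono (fun n => (hb n).1) tendsto_natCast_atTop_atTop, ?_⟩
  exact squeeze_zero (fun n => h0 _) (fun n => (hb n).2.le) tendsto_one_div_add_atTop_nhds_zero_nat

lemma MeasureTheory.Integrable.exists_seq_atBot {q : ℝ → ℝ} (hq : Integrable q)
    (h0 : ∀ x, 0 ≤ q x) : ∃ a : ℕ → ℝ, (∀ n, a n ≤ 0) ∧ Tendsto a atTop atBot ∧
      Tendsto (fun n => q (a n)) atTop (𝓝 0) := by
  obtain ⟨b, hb0, hb, hq'⟩ := hq.comp_neg.exists_seq_atTop fun x => h0 (-x)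
  exact ⟨fun n => -b n, fun n => by simpa using hb0 n, tendsto_neg_atTop_atBot.comp hb, hq'⟩

end MonotoneWeights

/-! ### The signed geometric mean of two monotone maps vanishing at the origin. -/

section GeomMean

/-- The geometric mean of two functions that have the sign of the variable, with that sign. -/
noncomputable def signedGeomMean (T S : ℝ → ℝ) (x : ℝ) : ℝ :=
  if 0 ≤ x then √(T x * S x) else -√(T x * S x)

variable {T S : ℝ → ℝ}

lemma signedGeomMean_sq (h : ∀ x, 0 ≤ T x * S x) (x : ℝ) :
    signedGeomMean T S x ^ 2 = T x * S x := by
  unfold signedGeomMean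
  split_ifs <;> simp [Real.sq_sqrt (h x)]

lemma signedGeomMean_nonneg {x : ℝ} (hx : 0 ≤ x) : 0 ≤ signedGeomMean T S x := by
  simp [signedGeomMean, hx]

lemma signedGeomMean_nonpos {x : ℝ} (hx : x < 0) : signedGeomMean T S x ≤ 0 := by
  simp [signedGeomMean, hx.not_ge]

lemma Monotone.mul_nonneg_of_zero (hT : Monotone T) (hS : Monotone S) (hT0 : T 0 = 0)
    (hS0 : S 0 = 0) (x : ℝ) : 0 ≤ T x * S x := by
  rcases le_total 0 x with hx | hx
  · exact mul_nonneg (hT0 ▸ hT hx) (hS0 ▸ hS hx)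
  · exact mul_nonneg_of_nonpos_of_nonpos (hT0 ▸ hT hx) (hS0 ▸ hS hx)

lemma monotone_signedGeomMean (hT : Monotone T) (hS : Monotone S) (hT0 : T 0 = 0)
    (hS0 : S 0 = 0) : Monotone (signedGeomMean T S) := by
  intro x y hxy
  rcases lt_or_ge x 0 with hx | hx
  · rcases lt_or_ge y 0 with hy | hy
    · simp only [signedGeomMean, hx.not_ge, hy.not_ge, if_false]
      apply neg_le_neg
      apply Real.sqrt_le_sqrt
      have h1 := hT hxy
      have h2 := hS hxy
      have h3 := hT0 ▸ hT hy.le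
      have h4 := hS0 ▸ hS hy.le
      nlinarith
    · exact (signedGeomMean_nonpos hx).trans (signedGeomMean_nonneg hy)
  · simp only [signedGeomMean, hx, hx.trans hxy, if_true]
    apply Real.sqrt_le_sqrt
    have h1 := hT hxy
    have h2 := hS hxy
    have h3 := hT0 ▸ hT hx
    have h4 := hS0 ▸ hS hx
    exact mul_le_mul h1 h2 h4 (h3.trans h1)

lemma signedGeomMean_le (hT : Monotone T) (hS : Monotone S) (hT0 : T 0 = 0)
    (hS0 : S 0 = 0) {x : ℝ} (hx : 0 ≤ x) : 2 * signedGeomMean T S x ≤ T x + S x := by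
  have h1 := signedGeomMean_sq (hT.mul_nonneg_of_zero hS hT0 hS0) x
  have h3 : 0 ≤ T x := hT0 ▸ hT hx
  have h4 : 0 ≤ S x := hS0 ▸ hS hx
  refine le_of_sq_le_sq ?_ (by positivity)
  nlinarith [sq_nonneg (T x - S x)]

lemma le_signedGeomMean (hT : Monotone T) (hS : Monotone S) (hT0 : T 0 = 0)
    (hS0 : S 0 = 0) {x : ℝ} (hx : x < 0) : T x + S x ≤ 2 * signedGeomMean T S x := by
  have h1 := signedGeomMean_sq (hT.mul_nonneg_of_zero hS hT0 hS0) x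
  have h3 : T x ≤ 0 := hT0 ▸ hT hx.le
  have h4 : S x ≤ 0 := hS0 ▸ hS hx.le
  have := abs_le_of_sq_le_sq (a := 2 * signedGeomMean T S x) (b := -(T x + S x))
    (by nlinarith [sq_nonneg (T x - S x)]) (by linarith)
  linarith [(abs_le.1 this).1]

/-- Differentiating `R² = TS` gives `2RR' = T'S + TS'`, whose square is at least `4 T'S' TS = 4 T'S'
R²`. Cancelling `R²` requires `x ≠ 0`. -/
lemma sqrt_deriv_mul_deriv_le_deriv_signedGeomMean (hT : StrictMono T) (hS : StrictMono S)
    (hT0 : T 0 = 0) (hS0 : S 0 = 0) {x : ℝ} (hx : x ≠ 0)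
    (hTx : DifferentiableAt ℝ T x) (hSx : DifferentiableAt ℝ S x)
    (hRx : DifferentiableAt ℝ (signedGeomMean T S) x) :
    √(deriv T x * deriv S x) ≤ deriv (signedGeomMean T S) x := by
  set R := signedGeomMean T S with hR
  have hnn := hT.monotone.mul_nonneg_of_zero hS.monotone hT0 hS0
  have hsq : (fun x => R x ^ 2) = fun x => T x * S x := funext (signedGeomMean_sq hnn)
  have h1 := (hRx.hasDerivAt.pow 2)
  have h2 := hTx.hasDerivAt.mul hSx.hasDerivAt
  have h3 : 2 * R x * deriv R x = deriv T x * S x + T x * deriv S x := by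
    have := h1.unique (f := fun x => R x ^ 2) (by rw [hsq]; exact h2)
    simpa using this
  have hR2 := congrFun hsq x
  have hpos : 0 < T x * S x := by
    rcases hx.lt_or_gt with h | h
    · exact mul_pos_of_neg_of_neg (hT0 ▸ hT h) (hS0 ▸ hS h)
    · exact mul_pos (hT0 ▸ hT h) (hS0 ▸ hS h)
  have hmon : Monotone R := monotone_signedGeomMean hT.monotone hS.monotone hT0 hS0
  rw [Real.sqrt_le_iff]
  refine ⟨hmon.deriv_nonneg, ?_⟩
  have h4 : (2 * R x * deriv R x) ^ 2 ≥ 4 * (deriv T x * deriv S x) * (T x * S x) := by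
    rw [h3]; nlinarith [sq_nonneg (deriv T x * S x - T x * deriv S x)]
  have h5 : (2 * R x * deriv R x) ^ 2 = 4 * deriv R x ^ 2 * (T x * S x) := by rw [← hR2]; ring
  rw [h5] at h4
  have := le_of_mul_le_mul_right h4 hpos
  linarith

end GeomMean

/-! ### The pointwise estimate and its integration. -/

section Core

open Set Filter Topology

/-- The pointwise estimate behind the Blaschke–Santaló inequality; `t`, `s` are the values of the
transport maps, `a`, `b` their values at the mode, `t'`, `s'` their derivatives, `r`, `r'` value and
derivative of the geometric mean, `d` the derivative of the potential. -/
lemma santalo_pointwise {κ t s x a b t' s' r r' d vx vt vs L : ℝ}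
    (ht' : 0 < t') (hs' : 0 < s') (hκ : 0 ≤ κ)
    (hL : L ≤ κ * ((t - s) ^ 2 / 2) - vt - vs + 2 * vx + Real.log t' + Real.log s')
    (hvt : vx + d * (t - x) + κ / 2 * (t - x) ^ 2 ≤ vt)
    (hvs : vx + d * (s - x) + κ / 2 * (s - x) ^ 2 ≤ vs)
    (hr : r ^ 2 = (t - a) * (s - b)) (hr' : √(t' * s') ≤ r')
    (hd : 0 ≤ (d - κ * x) * ((t - a) + (s - b) - 2 * r)) :
    L - κ * (-b * t - a * s + a * b + (a + b) * x) ≤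
      -(a + b) * d + 2 * (r' - d * r) - 2 * (1 - d * x) := by
  have hlog : Real.log t' + Real.log s' ≤ 2 * (r' - 1) := by
    have hsq := Real.sqrt_pos.2 (mul_pos ht' hs')
    rw [← Real.log_mul ht'.ne' hs'.ne', ← Real.sq_sqrt (mul_pos ht' hs').le, Real.log_pow]
    have := Real.log_le_sub_one_of_pos hsq
    push_cast
    linarith
  -- This is the square left over once the quadratic terms are collected and `t + s` is replaced by
  -- `a + b + 2r` using `hd`.
  have h1 : 0 ≤ κ * (r - x) ^ 2 := by positivity
  have h2 : κ * r ^ 2 = κ * ((t - a) * (s - b)) := by rw [hr]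
  nlinarith

variable {κ L : ℝ} {V V' T S : ℝ → ℝ}

lemma santalo_of_transport (hκ : 0 < κ) (hV : ∀ x, HasDerivAt V (V' x) x) (hV'c : Continuous V')
    (hV0 : V' 0 = 0) (hconv : ∀ x y, V x + V' x * (y - x) + κ / 2 * (y - x) ^ 2 ≤ V y)
    [IsProbabilityMeasure (gibbsMeasure V)]
    (hx : Integrable (fun x => x) (gibbsMeasure V))
    (hT : StrictMono T) (hS : StrictMono S)
    (hTi : Integrable T (gibbsMeasure V)) (hSi : Integrable S (gibbsMeasure V))
    (hL : ∀ᵐ x, 0 < deriv T x ∧ 0 < deriv S x ∧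
      L ≤ κ * ((T x - S x) ^ 2 / 2) - V (T x) - V (S x) + 2 * V x
        + Real.log (deriv T x) + Real.log (deriv S x)) :
    L ≤ κ * ∫ x, (-S 0 * T x - T 0 * S x + T 0 * S 0 + (T 0 + S 0) * x) ∂gibbsMeasure V := by
  have hVc : Continuous V := continuous_iff_continuousAt.2 fun x => (hV x).continuousAt
  have hVm : Measurable V := hVc.measurable
  -- Add the tangent inequalities from `x` to `0` and from `0` to `x`.
  have hsign : ∀ x, 0 ≤ (V' x - κ * x) * x := fun x => by
    have h1 := hconv x 0
    have h2 := hconv 0 x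
    rw [hV0] at h2
    nlinarith
  have hslope_pos : ∀ x, 0 ≤ x → 0 ≤ V' x - κ * x := fun x hx => by
    rcases hx.eq_or_lt with rfl | h
    · simp [hV0]
    · exact nonneg_of_mul_nonneg_left (hsign x) h
  have hslope_neg : ∀ x, x ≤ 0 → V' x - κ * x ≤ 0 := fun x hx => by
    rcases hx.eq_or_lt with rfl | h
    · simp [hV0]
    · by_contra! hc
      nlinarith [hsign x]
  set h : ℝ → ℝ := fun x => Real.exp (-V x) with hh
  set h' : ℝ → ℝ := fun x => -V' x * h x with hh'
  have hhd : ∀ x, HasDerivAt h (h' x) x := fun x => by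
    exact (hV x).neg.exp.congr_deriv (by simp only [hh', hh, Pi.neg_apply]; ring)
  have hhc : Continuous h := by fun_prop
  have hh'c : Continuous h' := by fun_prop
  have hhpos : ∀ x, 0 < h x := fun x => Real.exp_pos _
  set T₀ : ℝ → ℝ := fun x => T x - T 0 with hT₀
  set S₀ : ℝ → ℝ := fun x => S x - S 0 with hS₀
  have hT₀m : StrictMono T₀ := fun x y hxy => sub_lt_sub_right (hT hxy) _
  have hS₀m : StrictMono S₀ := fun x y hxy => sub_lt_sub_right (hS hxy) _
  have hT₀0 : T₀ 0 = 0 := sub_self _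
  have hS₀0 : S₀ 0 = 0 := sub_self _
  set R := signedGeomMean T₀ S₀ with hR
  have hRm : Monotone R := monotone_signedGeomMean hT₀m.monotone hS₀m.monotone hT₀0 hS₀0
  have hRle : ∀ x, 0 ≤ x → 2 * R x ≤ T₀ x + S₀ x := fun x hx =>
    signedGeomMean_le hT₀m.monotone hS₀m.monotone hT₀0 hS₀0 hx
  have hleR : ∀ x, x < 0 → T₀ x + S₀ x ≤ 2 * R x := fun x hx =>
    le_signedGeomMean hT₀m.monotone hS₀m.monotone hT₀0 hS₀0 hx
  set φ : ℝ → ℝ := fun x => -S 0 * T x - T 0 * S x + T 0 * S 0 + (T 0 + S 0) * x with hφ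
  have hφi : Integrable φ (gibbsMeasure V) :=
    (((hTi.const_mul _).sub (hSi.const_mul _)).add (integrable_const _)).add (hx.const_mul _)
  -- the pointwise inequality
  have hpt : ∀ᵐ x, h x * (L - κ * φ x) ≤ (T 0 + S 0) * h' x +
      2 * (deriv R x * h x + R x * h' x) - 2 * (h x + x * h' x) := by
    have hne : ∀ᵐ x : ℝ, x ≠ 0 := by simp [ae_iff]
    filter_upwards [hL, hne, hT.monotone.ae_differentiableAt, hS.monotone.ae_differentiableAt,
      hRm.ae_differentiableAt] with x ⟨h1, h2, h3⟩ hx0 hdT hdS hdR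
    have hdT₀ : deriv T₀ x = deriv T x := by simp [hT₀]
    have hdS₀ : deriv S₀ x = deriv S x := by simp [hS₀]
    have hsq := sqrt_deriv_mul_deriv_le_deriv_signedGeomMean hT₀m hS₀m hT₀0 hS₀0 hx0
      (hdT.sub_const _) (hdS.sub_const _) hdR
    rw [hdT₀, hdS₀] at hsq
    have hR2 := signedGeomMean_sq (hT₀m.monotone.mul_nonneg_of_zero hS₀m.monotone hT₀0 hS₀0) x
    have := santalo_pointwise (d := V' x) (x := x) h1 h2 hκ.le h3 (hconv _ _) (hconv _ _) hR2 hsq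
      (by
        rcases lt_or_ge x 0 with hx1 | hx1
        · exact mul_nonneg_of_nonpos_of_nonpos (hslope_neg x hx1.le) (by linarith [hleR x hx1])
        · exact mul_nonneg (hslope_pos x hx1) (by linarith [hRle x hx1]))
    have := mul_le_mul_of_nonneg_left this (hhpos x).le
    refine this.trans_eq ?_
    simp only [hh']; ring
  set g : ℝ → ℝ := fun x => h x * (L - κ * φ x) with hg
  have hgi : Integrable g :=
    (integrable_gibbsMeasure_iff hVm _).1 ((integrable_const L).sub (hφi.const_mul κ))
  -- integration over a bounded interval
  have hbd : ∀ a b : ℝ, a ≤ 0 → 0 ≤ b → ∫ x in a..b, g x ≤ (T 0 + S 0) * (h b - h a)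
      + 2 * (R b * h b - R a * h a) := by
    intro a b ha hb
    have hab := ha.trans hb
    obtain ⟨hi1, hi2⟩ := hRm.integral_deriv_mul_le hhd hh'c (fun x => (hhpos x).le)
      (fun x hx => by
        have := hslope_neg x hx
        have : V' x ≤ 0 := by nlinarith
        simp only [hh']; nlinarith [hhpos x])
      (fun x hx => by
        have := hslope_pos x hx
        have : 0 ≤ V' x := by nlinarith [mul_nonneg hκ.le hx]
        simp only [hh']; nlinarith [hhpos x]) hab
    have hi3 : IntervalIntegrable (fun x => R x * h' x) volume a b :=
      hRm.intervalIntegrable.mul_continuousOn hh'c.continuousOn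
    have hi4 : IntervalIntegrable (fun x => h x + x * h' x) volume a b :=
      (hhc.add (continuous_id.mul hh'c)).intervalIntegrable _ _
    have hi5 : IntervalIntegrable h' volume a b := hh'c.intervalIntegrable _ _
    have e5 : ∫ x in a..b, h' x = h b - h a :=
      intervalIntegral.integral_eq_sub_of_hasDerivAt (fun t _ => hhd t) hi5
    have e4 : ∫ x in a..b, (h x + x * h' x) = b * h b - a * h a := by
      refine intervalIntegral.integral_eq_sub_of_hasDerivAt (f := fun x => x * h x)
        (fun t _ => ?_) hi4
      exact ((hasDerivAt_id t).mul (hhd t)).congr_deriv (by simp)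
    have hle := intervalIntegral.integral_mono_ae hab hgi.intervalIntegrable
      (((hi5.const_mul (T 0 + S 0)).add ((hi1.add hi3).const_mul 2)).sub (hi4.const_mul 2)) hpt
    rw [intervalIntegral.integral_sub ((hi5.const_mul (T 0 + S 0)).add
      ((hi1.add hi3).const_mul 2)) (hi4.const_mul 2), intervalIntegral.integral_add
      (hi5.const_mul (T 0 + S 0)) ((hi1.add hi3).const_mul 2),
      intervalIntegral.integral_const_mul, intervalIntegral.integral_const_mul,
      intervalIntegral.integral_const_mul, intervalIntegral.integral_add hi1 hi3, e4, e5] at hle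
    -- The boundary term `-2 (b * h b - a * h a)` is nonpositive as `a ≤ 0 ≤ b`, so it is dropped
    -- without a limit.
    have h6 := mul_nonneg hb (hhpos b).le
    have h7 := mul_nonneg (neg_nonneg.2 ha) (hhpos a).le
    linarith
  -- the boundary terms vanish along suitable sequences
  have hhi : Integrable h := integrable_exp_neg hVm
  have hRi : Integrable (fun x => R x * h x) := by
    have hTS : Integrable (fun x => h x * (T₀ x + S₀ x)) :=
      (integrable_gibbsMeasure_iff hVm _).1
        ((hTi.sub (integrable_const _)).add (hSi.sub (integrable_const _)))
    refine Integrable.mono' hTS.abs (hRm.measurable.mul hhc.measurable).aestronglyMeasurable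
      (ae_of_all _ fun x => ?_)
    rw [Real.norm_eq_abs, abs_mul, abs_mul, mul_comm]
    refine mul_le_mul_of_nonneg_left ?_ (abs_nonneg _)
    rcases lt_or_ge x 0 with hx1 | hx1
    · have h1 := hleR x hx1
      have h2 : R x ≤ 0 := signedGeomMean_nonpos hx1
      rw [abs_of_nonpos h2, abs_of_nonpos (by linarith)]
      linarith
    · have h1 := hRle x hx1
      have h2 : 0 ≤ R x := signedGeomMean_nonneg hx1
      rw [abs_of_nonneg h2, abs_of_nonneg (by linarith)]
      linarith
  have hq : Integrable (fun x => |R x * h x| + h x) := hRi.abs.add hhi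
  have hq0 : ∀ x, 0 ≤ |R x * h x| + h x := fun x => add_nonneg (abs_nonneg _) (hhpos x).le
  have hlim : ∀ u : ℕ → ℝ, Tendsto (fun n => |R (u n) * h (u n)| + h (u n)) atTop (𝓝 0) →
      Tendsto (fun n => R (u n) * h (u n)) atTop (𝓝 0) ∧ Tendsto (fun n => h (u n)) atTop (𝓝 0) := by
    intro u hu
    refine ⟨squeeze_zero_norm (fun n => ?_) hu, squeeze_zero (fun n => (hhpos _).le) (fun n => ?_) hu⟩
    · rw [Real.norm_eq_abs]; linarith [hhpos (u n)]
    · linarith [abs_nonneg (R (u n) * h (u n))]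
  obtain ⟨b, hb0, hb, hbq⟩ := hq.exists_seq_atTop hq0
  obtain ⟨a, ha0, ha, haq⟩ := hq.exists_seq_atBot hq0
  obtain ⟨hb1, hb2⟩ := hlim b hbq
  obtain ⟨ha1, ha2⟩ := hlim a haq
  have hlimg := intervalIntegral_tendsto_integral hgi ha hb
  have hlimr : Tendsto (fun n => (T 0 + S 0) * (h (b n) - h (a n))
      + 2 * (R (b n) * h (b n) - R (a n) * h (a n))) atTop (𝓝 0) := by
    simpa using ((hb2.sub ha2).const_mul (T 0 + S 0)).add ((hb1.sub ha1).const_mul 2)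
  have hfin := le_of_tendsto_of_tendsto' hlimg hlimr fun n => hbd _ _ (ha0 n) (hb0 n)
  have : ∫ x, g x = L - κ * ∫ x, φ x ∂gibbsMeasure V := by
    rw [← integral_gibbsMeasure hVm (fun x => L - κ * φ x),
      integral_sub (integrable_const _) (hφi.const_mul _), integral_const_mul]
    simp
  rw [this] at hfin
  linarith

end Core

/-! ### The inequality for a strongly convex potential. -/

section General

open Set Filter Topology

variable {κ : ℝ} {V : ℝ → ℝ}

/-- Subtracting `κ / 2 * x ^ 2` leaves a convex function, which lies above its tangents. -/
lemma StrongConvexOn.tangent_add_sq_le (hV : StrongConvexOn univ κ V) {d x : ℝ}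
    (hd : HasDerivAt V d x) (y : ℝ) : V x + d * (y - x) + κ / 2 * (y - x) ^ 2 ≤ V y := by
  have hW := strongConvexOn_iff_convex.1 hV
  have hdW : HasDerivAt (fun x => V x - κ / 2 * ‖x‖ ^ 2) (d - κ * x) x := by
    have h1 := (((hasDerivAt_id x).pow 2).const_mul (κ / 2))
    have h2 := hd.sub h1
    simp only [Real.norm_eq_abs, sq_abs]
    exact h2.congr_deriv (by simp; ring)
  rcases lt_trichotomy x y with hxy | rfl | hxy
  · have := hW.le_slope_of_hasDerivAt (mem_univ x) (mem_univ y) hxy hdW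
    rw [slope_def_field, le_div_iff₀ (sub_pos.2 hxy)] at this
    simp only [Real.norm_eq_abs, sq_abs] at this
    linarith
  · simp
  · have := hW.slope_le_of_hasDerivAt (mem_univ y) (mem_univ x) hxy hdW
    rw [slope_def_field, div_le_iff₀ (sub_pos.2 hxy)] at this
    simp only [Real.norm_eq_abs, sq_abs] at this
    linarith

lemma integrable_sq_gibbsMeasure (hκ : 0 < κ) (hV : Continuous V)
    (hgrowth : ∀ x, V 0 + κ / 2 * x ^ 2 ≤ V x) :
    Integrable (fun x => x ^ 2) (gibbsMeasure V) := by
  rw [integrable_gibbsMeasure_iff hV.measurable]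
  have h1 : Integrable (fun x : ℝ => x ^ (2 : ℝ) * Real.exp (-(κ / 2) * x ^ 2)) :=
    integrable_rpow_mul_exp_neg_mul_sq (by positivity) (by norm_num)
  refine Integrable.mono' (h1.const_mul (Real.exp (-V 0))) (by fun_prop) (ae_of_all _ fun x => ?_)
  rw [Real.norm_of_nonneg (by positivity), Real.rpow_two, mul_left_comm, ← Real.exp_add, mul_comm]
  gcongr
  linarith [hgrowth x]

lemma integrable_id_of_sq {μ : Measure ℝ} [IsFiniteMeasure μ]
    (h : Integrable (fun x => x ^ 2) μ) : Integrable (fun x => x) μ :=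
  ((memLp_two_iff_integrable_sq measurable_id.aestronglyMeasurable).2 h).integrable one_le_two

namespace IsOptimalTransportMap

lemma integrable {μ ν : Measure ℝ} {T : ℝ → ℝ} (h : IsOptimalTransportMap μ ν T)
    (hν : Integrable (fun x => x) ν) : Integrable T μ := by
  rw [← h.map_eq] at hν
  exact hν.comp_measurable h.measurable

lemma integral_eq {μ ν : Measure ℝ} {T : ℝ → ℝ} (h : IsOptimalTransportMap μ ν T) :
    ∫ x, T x ∂μ = bary ν := by
  rw [bary, ← h.map_eq]
  exact (integral_map h.measurable.aemeasurable
    measurable_id.aestronglyMeasurable).symm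

end IsOptimalTransportMap

lemma isOptimalTransportMap_tilted [IsProbabilityMeasure (gibbsMeasure V)] (hV : Measurable V) {f : ℝ → ℝ}
    (hf : Measurable f) (hV2 : Integrable (fun x => x ^ 2) (gibbsMeasure V))
    (hi : Integrable (fun x => Real.exp (f x)) (gibbsMeasure V))
    (hi2 : Integrable (fun x => x ^ 2 * Real.exp (f x)) (gibbsMeasure V)) :
    IsProbabilityMeasure ((gibbsMeasure V).tilted f) ∧
      Integrable (fun x => x ^ 2) ((gibbsMeasure V).tilted f) ∧
      IsOptimalTransportMap (gibbsMeasure V) ((gibbsMeasure V).tilted f)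
        (optimalTransportMap (gibbsMeasure V) ((gibbsMeasure V).tilted f)) := by
  have h1 := isProbabilityMeasure_tilted hi
  have h2 : Integrable (fun x => x ^ 2) ((gibbsMeasure V).tilted f) :=
    (integrable_tilted_iff_mul_exp _ _ hi).2 hi2
  refine ⟨h1, h2, ?_⟩
  rw [tilted_gibbsMeasure hV hf hi] at h1 h2 ⊢
  exact optimalTransportMap_spec (by fun_prop) hV h2 hV2

lemma IsOptimalTransportMap.ae_log_deriv [IsProbabilityMeasure (gibbsMeasure V)]
    (hV : Measurable V) {f T : ℝ → ℝ} (hf : Measurable f)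
    (hi : Integrable (fun x => Real.exp (f x)) (gibbsMeasure V))
    (hT : IsOptimalTransportMap (gibbsMeasure V) ((gibbsMeasure V).tilted f) T) :
    StrictMono T ∧ ∀ᵐ x, 0 < deriv T x ∧
      Real.log (∫ x, Real.exp (f x) ∂gibbsMeasure V) =
        f (T x) - V (T x) + V x + Real.log (deriv T x) := by
  have h1 := isProbabilityMeasure_tilted hi
  rw [tilted_gibbsMeasure hV hf hi] at h1 hT
  refine ⟨hT.strictMono hV, ?_⟩
  filter_upwards [hT.ae_exp_mul_deriv (by fun_prop) hV] with x hx
  have hpos : 0 < deriv T x := by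
    by_contra! hc
    have := mul_nonpos_of_nonneg_of_nonpos (Real.exp_pos
      (-(V (T x) - f (T x) + Real.log (∫ x, Real.exp (f x) ∂gibbsMeasure V)))).le hc
    linarith [Real.exp_pos (-V x)]
  refine ⟨hpos, ?_⟩
  have := congrArg Real.log hx
  rw [Real.log_mul (Real.exp_pos _).ne' hpos.ne', Real.log_exp, Real.log_exp] at this
  linarith

theorem santalo_gibbsMeasure {F G : ℝ → ℝ} (hκ : 0 < κ) (hV : ContDiff ℝ ∞ V)
    (hsc : StrongConvexOn univ κ V) [IsProbabilityMeasure (gibbsMeasure V)]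
    (hmin : ∀ x, V 0 ≤ V x) (hF : Measurable F) (hG : Measurable G)
    (hFi : Integrable (fun x => Real.exp (κ * F x)) (gibbsMeasure V))
    (hFi2 : Integrable (fun x => x ^ 2 * Real.exp (κ * F x)) (gibbsMeasure V))
    (hGi : Integrable (fun x => Real.exp (κ * G x)) (gibbsMeasure V))
    (hGi2 : Integrable (fun x => x ^ 2 * Real.exp (κ * G x)) (gibbsMeasure V))
    (hFG : ∀ x y, F x + G y ≤ (x - y) ^ 2 / 2) :
    (∫ x, Real.exp (κ * F x) ∂gibbsMeasure V) * (∫ x, Real.exp (κ * G x) ∂gibbsMeasure V) ≤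
      Real.exp (κ * santaloPhi (gibbsMeasure V) ((gibbsMeasure V).tilted fun x => κ * F x)
        ((gibbsMeasure V).tilted fun x => κ * G x)) := by
  have hVm := hV.continuous.measurable
  have hd : ∀ x, HasDerivAt V (deriv V x) x := fun x =>
    ((hV.differentiable (by simp)) x).hasDerivAt
  have hd0 : deriv V 0 = 0 := IsLocalMin.deriv_eq_zero (Eventually.of_forall hmin)
  have hconv : ∀ x y, V x + deriv V x * (y - x) + κ / 2 * (y - x) ^ 2 ≤ V y := fun x y =>
    hsc.tangent_add_sq_le (hd x) y
  have hV2 := integrable_sq_gibbsMeasure hκ hV.continuous fun x => by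
    simpa [hd0] using hconv 0 x
  have hx := integrable_id_of_sq hV2
  obtain ⟨hFp, hF2, hT⟩ := isOptimalTransportMap_tilted hVm (hF.const_mul κ) hV2 hFi hFi2
  obtain ⟨hGp, hG2, hS⟩ := isOptimalTransportMap_tilted hVm (hG.const_mul κ) hV2 hGi hGi2
  obtain ⟨hTm, hTd⟩ := hT.ae_log_deriv hVm (hF.const_mul κ) hFi
  obtain ⟨hSm, hSd⟩ := hS.ae_log_deriv hVm (hG.const_mul κ) hGi
  have hTi := hT.integrable (integrable_id_of_sq hF2)
  have hSi := hS.integrable (integrable_id_of_sq hG2)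
  have hTb := hT.integral_eq
  have hSb := hS.integral_eq
  have hZF := integral_exp_pos hFi
  have hZG := integral_exp_pos hGi
  rw [santaloPhi, alpha, alpha]
  set T := optimalTransportMap (gibbsMeasure V) ((gibbsMeasure V).tilted fun x => κ * F x)
  set S := optimalTransportMap (gibbsMeasure V) ((gibbsMeasure V).tilted fun x => κ * G x)
  have hmain := santalo_of_transport hκ hd (hV.continuous_deriv (by simp)) hd0 hconv hx hTm hSm
    hTi hSi (L := Real.log (∫ x, Real.exp (κ * F x) ∂gibbsMeasure V) +
      Real.log (∫ x, Real.exp (κ * G x) ∂gibbsMeasure V)) (by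
      filter_upwards [hTd, hSd] with x ⟨h1, h2⟩ ⟨h3, h4⟩
      refine ⟨h1, h3, ?_⟩
      have := mul_le_mul_of_nonneg_left (hFG (T x) (S x)) hκ.le
      rw [h2, h4]
      linarith)
  rw [← Real.log_mul hZF.ne' hZG.ne', Real.log_le_iff_le_exp (mul_pos hZF hZG)] at hmain
  refine hmain.trans_eq ?_
  have h1 : Integrable (fun x => -S 0 * T x - T 0 * S x) (gibbsMeasure V) :=
    (hTi.const_mul _).sub (hSi.const_mul _)
  have h2 : Integrable (fun x => -S 0 * T x - T 0 * S x + T 0 * S 0) (gibbsMeasure V) :=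
    h1.add (integrable_const _)
  rw [integral_add h2 (hx.const_mul _), integral_add h1 (integrable_const _),
    integral_sub (hTi.const_mul _) (hSi.const_mul _), integral_const_mul, integral_const_mul,
    integral_const_mul, hTb, hSb]
  rw [integral_const_mul]
  simp [bary]

end General

/-! ### The Gaussian case and the bound by barycenters. -/

section Gaussian

open Set Filter Topology

/-- The potential of the standard Gaussian measure. -/
noncomputable def gaussianPotential (x : ℝ) : ℝ := 1 / 2 * x ^ 2 + Real.log √(2 * Real.pi)

lemma sqrt_two_pi_pos : 0 < √(2 * Real.pi) := Real.sqrt_pos.2 Real.two_pi_pos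

lemma exp_neg_gaussianPotential (x : ℝ) :
    Real.exp (-gaussianPotential x) = (√(2 * Real.pi))⁻¹ * Real.exp (-x ^ 2 / 2) := by
  rw [gaussianPotential, neg_add, Real.exp_add, Real.exp_neg (Real.log _),
    Real.exp_log sqrt_two_pi_pos, mul_comm]
  congr 2
  ring

lemma contDiff_gaussianPotential : ContDiff ℝ ∞ gaussianPotential := by
  unfold gaussianPotential; fun_prop

lemma measurable_gaussianPotential : Measurable gaussianPotential :=
  contDiff_gaussianPotential.continuous.measurable

lemma gaussianReal_eq_gibbsMeasure : gaussianReal 0 1 = gibbsMeasure gaussianPotential := by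
  rw [gaussianReal_of_var_ne_zero _ one_ne_zero, gibbsMeasure]
  congr 1 with x
  rw [gaussianPDF, gaussianPDFReal, exp_neg_gaussianPotential]
  simp

instance : IsProbabilityMeasure (gibbsMeasure gaussianPotential) := by
  rw [← gaussianReal_eq_gibbsMeasure]; infer_instance

lemma strongConvexOn_gaussianPotential : StrongConvexOn univ 1 gaussianPotential := by
  rw [strongConvexOn_iff_convex]
  simpa [gaussianPotential] using convexOn_const (𝕜 := ℝ) (Real.log √(2 * Real.pi)) convex_univ

lemma integral_gaussian_eq (f : ℝ → ℝ) :
    ∫ x, f x ∂gibbsMeasure gaussianPotential =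
      (√(2 * Real.pi))⁻¹ * ∫ x, Real.exp (-x ^ 2 / 2) * f x := by
  rw [integral_gibbsMeasure measurable_gaussianPotential, ← integral_const_mul]
  simp_rw [exp_neg_gaussianPotential, mul_assoc]

lemma integrable_gaussian_iff (f : ℝ → ℝ) : Integrable f (gibbsMeasure gaussianPotential) ↔
    Integrable (fun x => Real.exp (-x ^ 2 / 2) * f x) := by
  rw [integrable_gibbsMeasure_iff measurable_gaussianPotential]
  simp_rw [exp_neg_gaussianPotential, mul_assoc]
  rw [integrable_const_mul_iff (isUnit_iff_ne_zero.2 (inv_ne_zero sqrt_two_pi_pos.ne'))]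

lemma cdf_zero_of_even {U : ℝ → ℝ} (hU : Measurable U) (he : ∀ x, U (-x) = U x)
    [IsProbabilityMeasure (gibbsMeasure U)] : cdf (gibbsMeasure U) 0 = 1 / 2 := by
  have hi := integrable_exp_neg hU
  have h1 : ∫ x, Real.exp (-U x) = 1 := by
    have := integral_gibbsMeasure hU fun _ => (1 : ℝ)
    simpa using this.symm
  rw [← intervalIntegral.integral_Iic_add_Ioi hi.integrableOn hi.integrableOn (b := 0)] at h1
  have h2 := integral_comp_neg_Iic (0 : ℝ) (fun x => Real.exp (-U x))
  simp only [he, neg_zero] at h2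
  rw [cdf_eq_real, gibbsMeasure_real_apply hU measurableSet_Iic]
  linarith

lemma exists_cdf_eq_half {U : ℝ → ℝ} (hU : Measurable U)
    [IsProbabilityMeasure (gibbsMeasure U)] : ∃ z, cdf (gibbsMeasure U) z = 1 / 2 := by
  rw [← cdf_zero_of_even measurable_gaussianPotential (fun x => by simp [gaussianPotential])]
  exact exists_cdf_eq hU measurable_gaussianPotential 0

lemma exists_setIntegral_eq_half {f : ℝ → ℝ} (hf : Measurable f) (hpos : ∀ x, 0 < f x)
    (hi : Integrable f) : ∃ z, ∫ x in Ioi z, f x = (∫ x, f x) / 2 ∧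
      ∫ x in Iic z, f x = (∫ x, f x) / 2 := by
  have hI : 0 < ∫ x, f x := by
    rw [integral_pos_iff_support_of_nonneg (fun x => (hpos x).le) hi]
    have : Function.support f = univ := eq_univ_of_forall fun x => (hpos x).ne'
    simp [this]
  set U : ℝ → ℝ := fun x => -Real.log (f x / ∫ x, f x) with hUdef
  have hU : Measurable U := by fun_prop
  have hexp : ∀ x, Real.exp (-U x) = (∫ x, f x)⁻¹ * f x := fun x => by
    simp only [hUdef]
    rw [neg_neg, Real.exp_log (div_pos (hpos x) hI)]
    field_simp
  have hprob : IsProbabilityMeasure (gibbsMeasure U) := by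
    constructor
    rw [gibbsMeasure, withDensity_apply _ MeasurableSet.univ, setLIntegral_univ,
      ← ofReal_integral_eq_lintegral_ofReal]
    · simp_rw [hexp]
      rw [integral_const_mul, inv_mul_cancel₀ hI.ne', ENNReal.ofReal_one]
    · simp_rw [hexp]; exact hi.const_mul _
    · exact ae_of_all _ fun x => (Real.exp_pos _).le
  obtain ⟨z, hz⟩ := exists_cdf_eq_half hU
  rw [cdf_eq_real, gibbsMeasure_real_apply hU measurableSet_Iic] at hz
  simp_rw [hexp] at hz
  rw [integral_const_mul] at hz
  have h1 : ∫ x in Iic z, f x = (∫ x, f x) / 2 := by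
    field_simp at hz ⊢
    linarith
  have h2 := intervalIntegral.integral_Iic_add_Ioi hi.integrableOn hi.integrableOn (b := z)
  exact ⟨z, by linarith, h1⟩

/-- A pair of functions that are admissible for the dual transport problem. -/
structure IsSantaloPair (F G : ℝ → ℝ) : Prop where
  measurable_left : Measurable F
  measurable_right : Measurable G
  add_le : ∀ x y, F x + G y ≤ (x - y) ^ 2 / 2

namespace IsSantaloPair

variable {F G : ℝ → ℝ}

lemma symm (h : IsSantaloPair F G) : IsSantaloPair G F :=
  ⟨h.2, h.1, fun x y => by have := h.3 y x; linarith [show (x - y) ^ 2 = (y - x) ^ 2 by ring]⟩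

lemma comp_abs (h : IsSantaloPair F G) : IsSantaloPair (fun x => F |x|) (fun x => G |x|) := by
  have hF := h.1
  have hG := h.2
  refine ⟨by fun_prop, by fun_prop, fun x y => (h.3 _ _).trans ?_⟩
  have := sq_le_sq.2 (abs_abs_sub_abs_le_abs_sub x y)
  linarith

lemma comp_neg (h : IsSantaloPair F G) : IsSantaloPair (fun x => F (-x)) (fun x => G (-x)) := by
  have hF := h.1
  have hG := h.2
  refine ⟨by fun_prop, by fun_prop, fun x y => (h.3 _ _).trans_eq ?_⟩
  ring

/-- Translating `F` costs a linear term split between the two functions. The split is chosen so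
that, with the Gaussian factor included, the first weight is merely translated and the second is
tilted by `e^{zy}`. -/
lemma shift (h : IsSantaloPair F G) (z : ℝ) :
    IsSantaloPair (fun x => F (x + z) - z * x - z ^ 2 / 2) (fun y => G y + z * y) := by
  have hF := h.1
  have hG := h.2
  refine ⟨by fun_prop, by fun_prop, fun x y => ?_⟩
  have := h.3 (x + z) y
  nlinarith

/-- Testing the constraint at `y = -z` bounds the weight by any exponential up to a constant. Using
`z = 1` and `z = -1` gives decay like `e^{-|x|}`, so admissible pairs have all the moments needed.
-/
lemma exists_exp_le (h : IsSantaloPair F G) (z : ℝ) :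
    ∃ C, 0 < C ∧ ∀ x, Real.exp (-x ^ 2 / 2) * Real.exp (F x) ≤ C * Real.exp (z * x) := by
  refine ⟨Real.exp (z ^ 2 / 2 - G (-z)), Real.exp_pos _, fun x => ?_⟩
  rw [← Real.exp_add, ← Real.exp_add]
  refine Real.exp_le_exp.2 ?_
  have := h.3 x (-z)
  nlinarith

lemma integrable_one_add_sq_mul_exp (h : IsSantaloPair F G) :
    Integrable (fun x => (1 + x ^ 2) * (Real.exp (-x ^ 2 / 2) * Real.exp (F x))) := by
  obtain ⟨C, hC, hCb⟩ := h.exists_exp_le 1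
  obtain ⟨D, hD, hDb⟩ := h.exists_exp_le (-1)
  have hF := h.1
  refine Integrable.mono' (integrable_inv_one_add_sq.const_mul (29 * (C + D))) (by fun_prop)
    (ae_of_all _ fun x => ?_)
  rw [Real.norm_of_nonneg (by positivity)]
  have h1 : Real.exp (-x ^ 2 / 2) * Real.exp (F x) ≤ (C + D) * Real.exp (-|x|) := by
    rcases abs_cases x with ⟨hx, -⟩ | ⟨hx, -⟩
    · refine (hDb x).trans ?_
      rw [hx, neg_one_mul]; gcongr; linarith
    · refine (hCb x).trans ?_
      rw [hx, neg_neg, one_mul]; gcongr; linarith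
  -- `29 = 1 + 2 * 2! + 4!`, from `1`, `|x|² / 2!` and `|x|⁴ / 4!` each being at most `e^{|x|}`.
  have h2 : (1 + x ^ 2) ^ 2 ≤ 29 * Real.exp |x| := by
    have e2 := Real.pow_div_factorial_le_exp _ (abs_nonneg x) 2
    have e4 := Real.pow_div_factorial_le_exp _ (abs_nonneg x) 4
    have e0 := Real.one_le_exp (abs_nonneg x)
    have e5 : |x| ^ 4 = x ^ 4 := by rw [← abs_pow]; exact abs_of_nonneg (by positivity)
    rw [sq_abs] at e2
    rw [e5] at e4
    norm_num [Nat.factorial] at e2 e4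
    nlinarith
  rw [← div_eq_mul_inv, le_div_iff₀ (by positivity)]
  calc (1 + x ^ 2) * (Real.exp (-x ^ 2 / 2) * Real.exp (F x)) * (1 + x ^ 2)
      = (1 + x ^ 2) ^ 2 * (Real.exp (-x ^ 2 / 2) * Real.exp (F x)) := by ring
    _ ≤ (29 * Real.exp |x|) * ((C + D) * Real.exp (-|x|)) := by gcongr
    _ = 29 * (C + D) := by
      rw [Real.exp_neg]; field_simp

lemma integrable_left (h : IsSantaloPair F G) {p : ℝ → ℝ} (hp : Measurable p)
    (hb : ∀ x, |p x| ≤ 1 + x ^ 2) :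
    Integrable (fun x => Real.exp (-x ^ 2 / 2) * (p x * Real.exp (F x))) := by
  have hF := h.1
  refine Integrable.mono' h.integrable_one_add_sq_mul_exp (by fun_prop) (ae_of_all _ fun x => ?_)
  rw [Real.norm_eq_abs, mul_left_comm, abs_mul,
    abs_of_pos (a := Real.exp (-x ^ 2 / 2) * Real.exp (F x)) (by positivity)]
  gcongr
  exact hb x

lemma integrable_exp (h : IsSantaloPair F G) :
    Integrable (fun x => Real.exp (-x ^ 2 / 2) * Real.exp (F x)) := by
  simpa using h.integrable_left (p := fun _ => 1) measurable_const
    fun x => by rw [abs_one]; linarith [sq_nonneg x]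

lemma integrable_id_mul_exp (h : IsSantaloPair F G) :
    Integrable (fun x => Real.exp (-x ^ 2 / 2) * (x * Real.exp (F x))) :=
  h.integrable_left measurable_id fun x => by
    rw [abs_le]; constructor <;> nlinarith [sq_nonneg (x - 1), sq_nonneg (x + 1)]

lemma integrable_sq_mul_exp (h : IsSantaloPair F G) :
    Integrable (fun x => Real.exp (-x ^ 2 / 2) * (x ^ 2 * Real.exp (F x))) :=
  h.integrable_left (by fun_prop) fun x => by rw [abs_of_nonneg (sq_nonneg x)]; linarith

lemma santalo (h : IsSantaloPair F G) :
    (∫ x, Real.exp (F x) ∂gibbsMeasure gaussianPotential) *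
      (∫ x, Real.exp (G x) ∂gibbsMeasure gaussianPotential) ≤
      Real.exp (santaloPhi (gibbsMeasure gaussianPotential)
        ((gibbsMeasure gaussianPotential).tilted F)
        ((gibbsMeasure gaussianPotential).tilted G)) := by
  have := santalo_gibbsMeasure (F := F) (G := G) one_pos contDiff_gaussianPotential
    strongConvexOn_gaussianPotential (fun x => by simp [gaussianPotential]; positivity) h.1 h.2
    (by simpa using (integrable_gaussian_iff _).2 h.integrable_exp)
    (by simpa using (integrable_gaussian_iff _).2 h.integrable_sq_mul_exp)
    (by simpa using (integrable_gaussian_iff _).2 h.symm.integrable_exp)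
    (by simpa using (integrable_gaussian_iff _).2 h.symm.integrable_sq_mul_exp) h.3
  simpa only [one_mul] using this

lemma bary_tilted_eq (F : ℝ → ℝ) : bary ((gibbsMeasure gaussianPotential).tilted F) =
    (∫ x, Real.exp (-x ^ 2 / 2) * (x * Real.exp (F x))) /
      ∫ x, Real.exp (-x ^ 2 / 2) * Real.exp (F x) := by
  rw [bary, integral_tilted]
  simp only [smul_eq_mul, div_mul_eq_mul_div]
  rw [integral_div, integral_gaussian_eq, integral_gaussian_eq,
    mul_div_mul_left _ _ (inv_ne_zero sqrt_two_pi_pos.ne')]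
  simp_rw [mul_comm (Real.exp (F _))]

lemma alpha_tilted_of_even (h : IsSantaloPair F G) (he : ∀ x, F (-x) = F x) :
    alpha (gibbsMeasure gaussianPotential) ((gibbsMeasure gaussianPotential).tilted F) = 0 := by
  have hVm := measurable_gaussianPotential
  have hi := (integrable_gaussian_iff _).2 h.integrable_exp
  obtain ⟨hp, -, hT⟩ := isOptimalTransportMap_tilted hVm h.1
    (integrable_sq_gibbsMeasure one_pos contDiff_gaussianPotential.continuous
      (fun x => by simp [gaussianPotential]; linarith)) hi
    ((integrable_gaussian_iff _).2 h.integrable_sq_mul_exp)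
  rw [alpha]
  set T := optimalTransportMap (gibbsMeasure gaussianPotential)
    ((gibbsMeasure gaussianPotential).tilted F)
  have hF := h.1
  rw [tilted_gibbsMeasure hVm h.1 hi] at hp hT
  have h1 := hT.cdf_eq 0
  have hU : Measurable fun x => gaussianPotential x - F x +
    Real.log (∫ x, Real.exp (F x) ∂gibbsMeasure gaussianPotential) := by fun_prop
  rw [cdf_zero_of_even hVm (fun x => by simp [gaussianPotential]),
    ← cdf_zero_of_even hU (fun x => by simp [gaussianPotential, he])] at h1
  exact (strictMono_cdf_gibbsMeasure hU).injective h1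

/-- The Blaschke–Santaló inequality on the half-line. -/
lemma integral_Ioi_mul_integral_Ioi_le (h : IsSantaloPair F G) :
    (∫ x in Ioi 0, Real.exp (-x ^ 2 / 2) * Real.exp (F x)) *
      (∫ x in Ioi 0, Real.exp (-x ^ 2 / 2) * Real.exp (G x)) ≤ Real.pi / 2 := by
  -- The even extensions of the half-line restrictions remain admissible, and their `Φ` is `0`.
  have h1 := h.comp_abs.santalo
  rw [santaloPhi, h.comp_abs.alpha_tilted_of_even (by simp),
    h.comp_abs.symm.alpha_tilted_of_even (by simp), integral_gaussian_eq, integral_gaussian_eq] at h1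
  have e : ∀ H : ℝ → ℝ, ∫ x, Real.exp (-x ^ 2 / 2) * Real.exp (H |x|) =
      2 * ∫ x in Ioi 0, Real.exp (-x ^ 2 / 2) * Real.exp (H x) := fun H => by
    rw [← integral_comp_abs (f := fun x => Real.exp (-x ^ 2 / 2) * Real.exp (H x))]
    simp_rw [sq_abs]
  rw [e, e] at h1
  simp only [neg_zero, zero_mul, sub_zero, add_zero, Real.exp_zero] at h1
  have h2 : (√(2 * Real.pi))⁻¹ * (√(2 * Real.pi))⁻¹ = (2 * Real.pi)⁻¹ := by
    rw [← mul_inv, Real.mul_self_sqrt Real.two_pi_pos.le]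
  set A := ∫ x in Ioi 0, Real.exp (-x ^ 2 / 2) * Real.exp (F x)
  set B := ∫ x in Ioi 0, Real.exp (-x ^ 2 / 2) * Real.exp (G x)
  have h3 : (2 * Real.pi)⁻¹ * (4 * (A * B)) ≤ 1 := by
    rw [← h2]; linarith
  rw [inv_mul_le_iff₀ Real.two_pi_pos] at h3
  linarith

lemma integral_Iic_mul_integral_Iic_le (h : IsSantaloPair F G) :
    (∫ x in Iic 0, Real.exp (-x ^ 2 / 2) * Real.exp (F x)) *
      (∫ x in Iic 0, Real.exp (-x ^ 2 / 2) * Real.exp (G x)) ≤ Real.pi / 2 := by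
  have h1 := h.comp_neg.integral_Ioi_mul_integral_Ioi_le
  have e : ∀ H : ℝ → ℝ, ∫ x in Ioi 0, Real.exp (-x ^ 2 / 2) * Real.exp (H (-x)) =
      ∫ x in Iic 0, Real.exp (-x ^ 2 / 2) * Real.exp (H x) := fun H => by
    have := integral_comp_neg_Ioi (0 : ℝ) fun x => Real.exp (-x ^ 2 / 2) * Real.exp (H x)
    simpa using this
  rwa [e, e] at h1

/-- For some tilt of one of the functions the inequality for centered functions holds. -/
lemma exists_integral_mul_integral_le (h : IsSantaloPair F G) : ∃ z,
    (∫ x, Real.exp (-x ^ 2 / 2) * Real.exp (F x)) *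
      (∫ y, Real.exp (-y ^ 2 / 2) * Real.exp (G y + z * y)) ≤ 2 * Real.pi := by
  have hF := h.1
  -- `z` is the median of the first weight: after the shift both half-line bounds carry the same
  -- factor, half its mass, so they add up.
  obtain ⟨z, hz1, hz2⟩ := exists_setIntegral_eq_half (f := fun x =>
    Real.exp (-x ^ 2 / 2) * Real.exp (F x)) (by fun_prop) (fun x => by positivity) h.integrable_exp
  refine ⟨z, ?_⟩
  have hs := h.shift z
  have e : ∀ x, Real.exp (-x ^ 2 / 2) * Real.exp (F (x + z) - z * x - z ^ 2 / 2) =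
      Real.exp (-(x + z) ^ 2 / 2) * Real.exp (F (x + z)) := fun x => by
    rw [← Real.exp_add, ← Real.exp_add]; congr 1; ring
  have hI : ∀ (f : ℝ → ℝ), ∫ x in Ioi 0, f (x + z) = ∫ x in Ioi z, f x := fun f => by
    rw [← integral_indicator measurableSet_Ioi, ← integral_indicator measurableSet_Ioi,
      ← integral_add_right_eq_self ((Ioi z).indicator f) z]
    congr 1 with x
    simp [indicator]
  have hI' : ∀ (f : ℝ → ℝ), ∫ x in Iic 0, f (x + z) = ∫ x in Iic z, f x := fun f => by
    rw [← integral_indicator measurableSet_Iic, ← integral_indicator measurableSet_Iic,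
      ← integral_add_right_eq_self ((Iic z).indicator f) z]
    congr 1 with x
    simp [indicator]
  have h1 := hs.integral_Ioi_mul_integral_Ioi_le
  have h2 := hs.integral_Iic_mul_integral_Iic_le
  simp_rw [e] at h1 h2
  rw [hI fun x => Real.exp (-x ^ 2 / 2) * Real.exp (F x), hz1] at h1
  rw [hI' fun x => Real.exp (-x ^ 2 / 2) * Real.exp (F x), hz2] at h2
  have hi := hs.symm.integrable_exp
  rw [← intervalIntegral.integral_Iic_add_Ioi hi.integrableOn hi.integrableOn (b := 0)]
  linarith

lemma integral_exp_pos (h : IsSantaloPair F G) :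
    0 < ∫ x, Real.exp (-x ^ 2 / 2) * Real.exp (F x) := by
  have h1 := h.integrable_exp
  simp_rw [← Real.exp_add] at h1 ⊢
  exact MeasureTheory.integral_exp_pos h1

/-- For a centered weight, `e^{zy} ≥ 1 + zy` shows that a linear tilt cannot lower the total mass,
whatever `z` is. -/
lemma integral_mul_integral_le_of_centered (h : IsSantaloPair F G)
    (h0 : ∫ y, Real.exp (-y ^ 2 / 2) * (y * Real.exp (G y)) = 0) :
    (∫ x, Real.exp (-x ^ 2 / 2) * Real.exp (F x)) *
      (∫ y, Real.exp (-y ^ 2 / 2) * Real.exp (G y)) ≤ 2 * Real.pi := by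
  obtain ⟨z, hz⟩ := h.exists_integral_mul_integral_le
  refine le_trans (mul_le_mul_of_nonneg_left ?_ h.integral_exp_pos.le) hz
  have h1 := h.symm.integrable_exp
  have h2 := h.symm.integrable_id_mul_exp
  calc ∫ y, Real.exp (-y ^ 2 / 2) * Real.exp (G y)
      = ∫ y, (Real.exp (-y ^ 2 / 2) * Real.exp (G y) +
          z * (Real.exp (-y ^ 2 / 2) * (y * Real.exp (G y)))) := by
        rw [integral_add h1 (h2.const_mul z), integral_const_mul, h0, mul_zero, add_zero]
    _ ≤ ∫ y, Real.exp (-y ^ 2 / 2) * Real.exp (G y + z * y) := by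
        refine integral_mono (h1.add (h2.const_mul z)) (h.shift z).symm.integrable_exp fun y => ?_
        simp only
        rw [Real.exp_add (G y)]
        have := mul_le_mul_of_nonneg_left (Real.add_one_le_exp (z * y))
          (mul_pos (Real.exp_pos (-y ^ 2 / 2)) (Real.exp_pos (G y))).le
        linarith

theorem integral_mul_integral_le_exp_bary (h : IsSantaloPair F G) :
    (∫ x, Real.exp (F x) ∂gibbsMeasure gaussianPotential) *
      (∫ x, Real.exp (G x) ∂gibbsMeasure gaussianPotential) ≤
      Real.exp (-(bary ((gibbsMeasure gaussianPotential).tilted F) *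
        bary ((gibbsMeasure gaussianPotential).tilted G))) := by
  set b := bary ((gibbsMeasure gaussianPotential).tilted G) with hb
  set c := bary ((gibbsMeasure gaussianPotential).tilted F) with hc
  have hposF := h.integral_exp_pos
  have hposG := h.symm.integral_exp_pos
  rw [bary_tilted_eq, eq_div_iff hposG.ne'] at hb
  rw [bary_tilted_eq, eq_div_iff hposF.ne'] at hc
  -- Translation by the barycenter `b` centers the weight of `G` and tilts that of `F` by `e^{bx}`.
  have hs := (h.symm.shift b).symm
  have e : ∀ x, Real.exp (-x ^ 2 / 2) * Real.exp (G (x + b) - b * x - b ^ 2 / 2) =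
      Real.exp (-(x + b) ^ 2 / 2) * Real.exp (G (x + b)) := fun x => by
    rw [← Real.exp_add, ← Real.exp_add]; congr 1; ring
  have hiG := h.symm.integrable_exp
  have hiG' := h.symm.integrable_id_mul_exp
  have hcent := hs.integral_mul_integral_le_of_centered (by
    have e' : ∀ x, Real.exp (-x ^ 2 / 2) * (x * Real.exp (G (x + b) - b * x - b ^ 2 / 2)) =
        (fun y => Real.exp (-y ^ 2 / 2) * (y * Real.exp (G y)) -
          b * (Real.exp (-y ^ 2 / 2) * Real.exp (G y))) (x + b) := fun x => by
      have := e x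
      simp only
      linear_combination x * this
    rw [integral_congr_ae (ae_of_all _ e'), integral_add_right_eq_self (fun y =>
      Real.exp (-y ^ 2 / 2) * (y * Real.exp (G y)) - b * (Real.exp (-y ^ 2 / 2) * Real.exp (G y))) b,
      integral_sub hiG' (hiG.const_mul b), integral_const_mul, ← hb]
    ring)
  simp_rw [e] at hcent
  rw [integral_add_right_eq_self fun y => Real.exp (-y ^ 2 / 2) * Real.exp (G y)] at hcent
  have hiF := h.integrable_exp
  have hiF' := h.integrable_id_mul_exp
  -- Jensen's inequality for the tilt, via the tangent to the exponential at `b * c`; it supplies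
  -- the factor `e^{bc}` of the conclusion.
  have hjensen : Real.exp (b * c) * ∫ x, Real.exp (-x ^ 2 / 2) * Real.exp (F x) ≤
      ∫ x, Real.exp (-x ^ 2 / 2) * Real.exp (F x + b * x) := by
    calc Real.exp (b * c) * ∫ x, Real.exp (-x ^ 2 / 2) * Real.exp (F x)
        = ∫ x, (Real.exp (b * c) * (1 - b * c) * (Real.exp (-x ^ 2 / 2) * Real.exp (F x)) +
            Real.exp (b * c) * b * (Real.exp (-x ^ 2 / 2) * (x * Real.exp (F x)))) := by
          rw [integral_add (hiF.const_mul _) (hiF'.const_mul _), integral_const_mul,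
            integral_const_mul, ← hc]
          ring
      _ ≤ _ := by
          refine integral_mono ((hiF.const_mul _).add (hiF'.const_mul _)) hs.integrable_exp
            fun x => ?_
          have h1 := Real.add_one_le_exp (b * x - b * c)
          have h2 := mul_le_mul_of_nonneg_left h1 (mul_pos (Real.exp_pos (b * c))
            (mul_pos (Real.exp_pos (-x ^ 2 / 2)) (Real.exp_pos (F x)))).le
          have h3 : Real.exp (F x + b * x) =
              Real.exp (b * c) * Real.exp (F x) * Real.exp (b * x - b * c) := by
            rw [← Real.exp_add, ← Real.exp_add]; congr 1; ring
          rw [h3]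
          linarith
  rw [integral_gaussian_eq, integral_gaussian_eq]
  set A := ∫ x, Real.exp (-x ^ 2 / 2) * Real.exp (F x)
  set B := ∫ x, Real.exp (-x ^ 2 / 2) * Real.exp (G x)
  have h2 : (√(2 * Real.pi))⁻¹ * (√(2 * Real.pi))⁻¹ = (2 * Real.pi)⁻¹ := by
    rw [← mul_inv, Real.mul_self_sqrt Real.two_pi_pos.le]
  have h3 := (mul_le_mul_of_nonneg_right hjensen hposG.le).trans hcent
  calc (√(2 * Real.pi))⁻¹ * A * ((√(2 * Real.pi))⁻¹ * B) = (2 * Real.pi)⁻¹ * (A * B) := by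
        rw [← h2]; ring
    _ ≤ Real.exp (-(c * b)) := by
        rw [inv_mul_le_iff₀ Real.two_pi_pos, Real.exp_neg, ← div_eq_mul_inv,
          le_div_iff₀ (Real.exp_pos _), mul_comm c b]
        linarith

end IsSantaloPair

end Gaussian

/-- The measure `m.tilted f` is `e^f m / ∫ e^f dm`. -/
theorem theorem6p2 :
    (∀ (κ : ℝ) (V F G : ℝ → ℝ) (m : Measure ℝ), 0 < κ →
      ContDiff ℝ ∞ V → StrongConvexOn Set.univ κ V →
      m = gibbsMeasure V → IsProbabilityMeasure m →
      (∀ x, V 0 ≤ V x) →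
      Measurable F → Measurable G →
      Integrable (fun x => Real.exp (κ * F x)) m →
      Integrable (fun x => x ^ 2 * Real.exp (κ * F x)) m →
      Integrable (fun x => Real.exp (κ * G x)) m →
      Integrable (fun x => x ^ 2 * Real.exp (κ * G x)) m →
      (∀ x y, F x + G y ≤ (x - y) ^ 2 / 2) →
      (∫ x, Real.exp (κ * F x) ∂m) * (∫ x, Real.exp (κ * G x) ∂m) ≤
        Real.exp (κ * santaloPhi m (m.tilted fun x => κ * F x) (m.tilted fun x => κ * G x))) ∧
    (∀ (F G : ℝ → ℝ) (γ μF μG : Measure ℝ), γ = gaussianReal 0 1 →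
      μF = γ.tilted F → μG = γ.tilted G →
      Measurable F → Measurable G →
      Integrable (fun x => Real.exp (F x)) γ →
      Integrable (fun x => x ^ 2 * Real.exp (F x)) γ →
      Integrable (fun x => Real.exp (G x)) γ →
      Integrable (fun x => x ^ 2 * Real.exp (G x)) γ →
      (∀ x y, F x + G y ≤ (x - y) ^ 2 / 2) →
      santaloPhi γ μF μG =
        -alpha γ μG * bary μF - alpha γ μF * bary μG + alpha γ μF * alpha γ μG ∧
      (∫ x, Real.exp (F x) ∂γ) * (∫ x, Real.exp (G x) ∂γ) ≤
        Real.exp (min (santaloPhi γ μF μG) (-(bary μF * bary μG)))) := by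
  refine ⟨?_, ?_⟩
  · rintro κ V F G m hκ hV hsc rfl hm hmin hF hG hFi hFi2 hGi hGi2 hFG
    exact santalo_gibbsMeasure hκ hV hsc hmin hF hG hFi hFi2 hGi hGi2 hFG
  · rintro F G γ μF μG hγ rfl rfl hF hG - - - - hFG
    have hb : bary γ = 0 := by rw [hγ, bary, integral_id_gaussianReal]
    rw [gaussianReal_eq_gibbsMeasure] at hγ
    have h : IsSantaloPair F G := ⟨hF, hG, hFG⟩
    refine ⟨by rw [santaloPhi, hb]; ring, ?_⟩
    subst hγ
    rcases min_choice (santaloPhi (gibbsMeasure gaussianPotential)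
        ((gibbsMeasure gaussianPotential).tilted F) ((gibbsMeasure gaussianPotential).tilted G))
      (-(bary ((gibbsMeasure gaussianPotential).tilted F) *
        bary ((gibbsMeasure gaussianPotential).tilted G))) with hmin | hmin
    · rw [hmin]; exact h.santalo
    · rw [hmin]; exact h.integral_mul_integral_le_exp_bary
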